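/- Use units in which the speed of light, the particle mass and the Boltzmann constant are $1$. For $\nu\ge 0$ and $\zeta>0$ let $K_\nu(\zeta)=\int_0^\infty\cosh(\nu\vartheta)\,e^{-\zeta\cosh\vartheta}\,d\vartheta$ and $G(\zeta)=K_3(\zeta)/K_2(\zeta)$. A state of the gas is a triple $(\rho,u,p)$ (rest mass density, velocity, pressure) with $\rho>0$, $p>0$, $|u|<1$. Put $\zeta=\rho/p$. The Synge equation of state is $e=G(\zeta)-\zeta^{-1}-1$, $h=G(\zeta)$ (specific internal energy and specific enthalpy), and the speed of sound is $$c_s=\sqrt{\frac{p/\rho^2-(\partial e/\partial\rho)_p}{h\,(\partial e/\partial p)_\rho}} .$$ With $U^0=(1-u^2)^{-1/2}$ and $U^1=U^0u$, the 1D special relativistic Euler equations are $\partial_t W+\partial_x F=0$, where $$W=(\rho U^0,\ \rho hU^0U^1,\ \rho hU^0U^0-p),\qquad F=(\rho U^1,\ \rho hU^1U^1+p,\ \rho hU^1U^0),$$ and the characteristic speeds are $\lambda_\mp=\dfrac{u\mp c_s}{1\mp uc_s}$ and $\lambda_0=u$. Let $l=(\rho_l,u_l,p_l)$ and $r=(\rho_r,u_r,p_r)$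 be the left and right states of an elementary wave, in the following sense. - A shock of the field $\lambda_\pm$ is a discontinuity between $l$ and $r$ with some speed $s$ such that the Rankine–Hugoniot conditions $s\,(W_r-W_l)=F_r-F_l$ and the Lax entropy condition $\lambda_\pm(r)<s<\lambda_\pm(l)$ hold. - A rarefaction wave of the field $\lambda_\pm$ is a self-similar solution $V(x/t)$ with values in the states, defined on a fan $\xi_l\le x/t\le\xi_r$ with $\xi_l<\xi_r$, continuous on the closed fan and differentiable in its interior, with $V(\xi_l)=l$, $V(\xi_r)=r$ and $\lambda_\pm(V(\xi))=\xi$. Here the Euler equations read $\frac{d}{d\xi}F(V(\xi))=\xi\,\frac{d}{d\xi}W(V(\xi))$. - A wave of the field $\lambda_0$ (a contact discontinuity) is a discontinuity between $l$ and $r$ that satisfies the Rankine–Hugoniot conditions with a speed $s$ equal to the value of $\lambda_0$ at one of the two states. **Theorem.** For the field $\lambda_-$, a shock satisfies $p_l<p_r$ and $u_l>u_r$, and a rarefaction wave satisfies $p_l>p_r$ and $u_l<u_r$. For the field $\lambda_+$, a shock satisfies $p_l>p_r$ and $u_l>u_r$, and a rarefaction wave satisfies $p_l<p_r$ and $u_l<u_r$.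 For the field $\lambda_0$, $p_l=p_r$ and $u_l=u_r$. -/

import Mathlib

noncomputable section

namespace SyngeRHD

open Set

/-! Units: speed of light, particle mass and Boltzmann constant are equal to one. -/

/-- Modified Bessel function of the second kind,
`K_ν(ζ) = ∫_0^∞ cosh(ν ϑ) exp(-ζ cosh ϑ) dϑ`. -/
def besselK (ν ζ : ℝ) : ℝ :=
  ∫ ϑ in Ioi (0 : ℝ), Real.cosh (ν * ϑ) * Real.exp (-ζ * Real.cosh ϑ)

/-- `G(ζ) = K_3(ζ) / K_2(ζ)`. -/
def G (ζ : ℝ) : ℝ := besselK 3 ζ / besselK 2 ζ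

/-- The coldness `ζ = 1 / T`, where `p = ρ T`. -/
def zeta (ρ p : ℝ) : ℝ := ρ / p

/-- Specific internal energy given by the Synge equation of state, `e = G(ζ) - ζ⁻¹ - 1`. -/
def internalEnergy (ρ p : ℝ) : ℝ := G (zeta ρ p) - (zeta ρ p)⁻¹ - 1

/-- Specific enthalpy given by the Synge equation of state, `h = 1 + e + p / ρ = G(ζ)`. -/
def enthalpy (ρ p : ℝ) : ℝ := G (zeta ρ p)

/-- Speed of sound,
`c_s² = (p / ρ² - (∂e/∂ρ)_p) / (h (∂e/∂p)_ρ)`. -/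
def soundSpeed (ρ p : ℝ) : ℝ :=
  Real.sqrt ((p / ρ ^ 2 - deriv (fun r => internalEnergy r p) ρ) /
    (enthalpy ρ p * deriv (fun q => internalEnergy ρ q) p))

/-- Primitive variables of the one-dimensional flow: rest mass density `ρ`, velocity `u`,
pressure `p`. -/
structure FluidState where
  ρ : ℝ
  u : ℝ
  p : ℝ

namespace FluidState

/-- Physically admissible states: positive density, positive pressure (equivalently positive
temperature), and velocity below the speed of light. -/
def Admissible (V : FluidState) : Prop := 0 < V.ρ ∧ 0 < V.p ∧ |V.u| < 1

/-- Component `U⁰` of the velocity four-vector (the Lorentz factor). -/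
def U0 (V : FluidState) : ℝ := 1 / Real.sqrt (1 - V.u ^ 2)

/-- Component `U¹` of the velocity four-vector. -/
def U1 (V : FluidState) : ℝ := V.U0 * V.u

/-- Specific enthalpy of the state. -/
def h (V : FluidState) : ℝ := enthalpy V.ρ V.p

/-- Speed of sound of the state. -/
def cs (V : FluidState) : ℝ := soundSpeed V.ρ V.p

/-- Conserved variables `W = (ρ U⁰, ρ h U⁰ U¹, ρ h U⁰ U⁰ - p)`. -/
def W (V : FluidState) : Fin 3 → ℝ :=
  ![V.ρ * V.U0, V.ρ * V.h * V.U0 * V.U1, V.ρ * V.h * V.U0 * V.U0 - V.p]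

/-- Flux `F = (ρ U¹, ρ h U¹ U¹ + p, ρ h U¹ U⁰)`; the Euler equations are `∂ₜ W + ∂ₓ F = 0`. -/
def F (V : FluidState) : Fin 3 → ℝ :=
  ![V.ρ * V.U1, V.ρ * V.h * V.U1 * V.U1 + V.p, V.ρ * V.h * V.U1 * V.U0]

/-- Characteristic speed `λ_-`. -/
def lambdaMinus (V : FluidState) : ℝ := (V.u - V.cs) / (1 - V.u * V.cs)

/-- Characteristic speed `λ_0`. -/
def lambdaZero (V : FluidState) : ℝ := V.u

/-- Characteristic speed `λ_+`. -/
def lambdaPlus (V : FluidState) : ℝ := (V.u + V.cs) / (1 + V.u * V.cs)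

end FluidState

/-- Rankine-Hugoniot conditions for a discontinuity of speed `s` with left state `l` and right
state `r`. -/
def RankineHugoniot (s : ℝ) (l r : FluidState) : Prop := s • (r.W - l.W) = r.F - l.F

/-- Shock wave of the characteristic field with speed `lam`: a discontinuity that satisfies the
Rankine-Hugoniot conditions and the Lax entropy condition `lam(r) < s < lam(l)`. -/
def IsShock (lam : FluidState → ℝ) (l r : FluidState) : Prop :=
  ∃ s : ℝ, RankineHugoniot s l r ∧ lam r < s ∧ s < lam l

/-- Centered rarefaction wave of the characteristic field with speed `lam`: a self-similar
solution `V(x / t)` of the Euler equations, continuous on the closed fan `ξl ≤ x / t ≤ ξr` and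
differentiable inside, that joins `l` to `r` and has `lam (V ξ) = ξ`. For such a function
`∂ₜ W + ∂ₓ F = 0` reads `(F ∘ V)' = ξ (W ∘ V)'`. -/
def IsRarefaction (lam : FluidState → ℝ) (l r : FluidState) : Prop :=
  ∃ (ξl ξr : ℝ) (V : ℝ → FluidState), ξl < ξr ∧ V ξl = l ∧ V ξr = r ∧
    (∀ ξ ∈ Icc ξl ξr, (V ξ).Admissible ∧ lam (V ξ) = ξ) ∧
    ContinuousOn (fun ξ => (V ξ).ρ) (Icc ξl ξr) ∧
    ContinuousOn (fun ξ => (V ξ).u) (Icc ξl ξr) ∧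
    ContinuousOn (fun ξ => (V ξ).p) (Icc ξl ξr) ∧
    ∀ ξ ∈ Ioo ξl ξr,
      DifferentiableAt ℝ (fun η => (V η).ρ) ξ ∧
      DifferentiableAt ℝ (fun η => (V η).u) ξ ∧
      DifferentiableAt ℝ (fun η => (V η).p) ξ ∧
      ∃ D : Fin 3 → ℝ, HasDerivAt (fun η => (V η).W) D ξ ∧ HasDerivAt (fun η => (V η).F) (ξ • D) ξ

/-- Contact discontinuity, the wave of the characteristic field `λ_0`: a discontinuity that
satisfies the Rankine-Hugoniot conditions and moves with the characteristic speed `λ_0`. That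
`λ_0` has the same value on both sides is not assumed: the speed need only be that of one side. -/
def IsContact (l r : FluidState) : Prop :=
  ∃ s : ℝ, RankineHugoniot s l r ∧ (s = l.lambdaZero ∨ s = r.lambdaZero)

end SyngeRHD

end

/-!
Both acoustic fields are handled at once: the reflection `x ↦ -x` maps a wave of the field `λ_+` with
left state `l` and right state `r` to a wave of the field `λ_-` with the two sides exchanged. Contact
discontinuities have no mass flux, and then the Rankine-Hugoniot conditions give the claim.

What decides the signs for `λ_-` is genuine nonlinearity, `genuinely_nonlinear`. Write `g = ζ G` and
let `a = -ζ² G'(ζ)` be the specific heat at constant pressure. The Riccati equation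
`G' = G² - 5 G / ζ - 1`, a consequence of the recurrences for `K_ν`, makes `a` and `c_s⁻²` rational
functions of `ζ` and `g`, with derivatives of the same kind. Genuine nonlinearity then becomes a
polynomial inequality, which holds as soon as `g > 4` and `a > 5/2`. The first bound is the recurrence
`K₃ = K₁ + 4 K₂ / ζ`. The second one, `specificHeat_gt`, is a bound of Turán type on `K₃ / K₂`: the
function `(5/2 - a) K₂² / ζ` has derivative `(15/2) K₂² / ζ²` and an upper bound that tends to zero at
infinity, so it is negative.

For a shock, the Lax condition makes the inflow on the left supersonic in the frame of the shock.
The two states satisfy the Taub relation `h_r² - h_l² = (p_r - p_l) (h_l / ρ_l + h_r / ρ_r)` and are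
joined by a chord in the plane of the pressure and the dynamical volume `h / ρ`, where the isentropes
are strictly convex. If the pressure dropped, the isentrope through the left state would lie above the
chord, and the comparison of volumes and of enthalpies at the pressure `p_r` would be contradictory
(`pressure_le_of_taub`). So the pressure rises, the dynamical volume falls, and with it the velocity,
because the velocity relative to the shock is proportional to `h / ρ`.

For a rarefaction wave, the Euler equations express the derivatives of `p` and `u` in the fan by
that of `ζ`, and the derivative of `λ_-(V(ξ)) = ξ` determines the sign of the latter by genuine
nonlinearity (`rarefaction_deriv_signs`).
-/

noncomputable section

namespace SyngeRHD

open Set Filter Topology MeasureTheory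

/-! ### Modified Bessel functions -/

lemma tendsto_exp_mul_exp_neg_cosh (c : ℝ) {z : ℝ} (hz : 0 < z) :
    Tendsto (fun θ : ℝ => Real.exp (c * θ) * Real.exp (-z * Real.cosh θ)) atTop (𝓝 0) := by
  have h := (tendsto_rpow_mul_exp_neg_mul_atTop_nhds_zero c (z / 2) (by positivity)).comp
    Real.tendsto_exp_atTop
  refine squeeze_zero (fun θ => by positivity) (fun θ => ?_) h
  simp only [Function.comp_apply]
  rw [← Real.exp_mul, mul_comm θ c]
  refine mul_le_mul_of_nonneg_left (Real.exp_le_exp.2 ?_) (Real.exp_pos _).le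
  rw [Real.cosh_eq]
  nlinarith [mul_pos hz (Real.exp_pos (-θ))]

lemma tendsto_sinh_mul_exp_neg_cosh (c : ℝ) {z : ℝ} (hz : 0 < z) :
    Tendsto (fun θ : ℝ => Real.sinh (c * θ) * Real.exp (-z * Real.cosh θ)) atTop (𝓝 0) := by
  have h := ((tendsto_exp_mul_exp_neg_cosh c hz).sub
    (tendsto_exp_mul_exp_neg_cosh (-c) hz)).div_const 2
  simp only [sub_zero, zero_div] at h
  refine h.congr fun θ => ?_
  rw [Real.sinh_eq (c * θ), neg_mul c θ]
  ring

lemma integrableOn_besselK (ν : ℝ) {z : ℝ} (hz : 0 < z) :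
    IntegrableOn (fun θ : ℝ => Real.cosh (ν * θ) * Real.exp (-z * Real.cosh θ)) (Ioi 0) := by
  refine integrable_of_isBigO_exp_neg one_pos (by fun_prop) ?_
  refine (Asymptotics.isLittleO_of_tendsto (fun θ h => absurd h (Real.exp_ne_zero _)) ?_).isBigO
  have h := ((tendsto_exp_mul_exp_neg_cosh (ν + 1) hz).add
    (tendsto_exp_mul_exp_neg_cosh (-ν + 1) hz)).div_const 2
  simp only [add_zero, zero_div] at h
  refine h.congr fun θ => ?_
  rw [Real.cosh_eq (ν * θ), div_eq_mul_inv _ (Real.exp (-1 * θ)), ← Real.exp_neg, add_mul, add_mul,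
    Real.exp_add, Real.exp_add, neg_mul ν θ]
  ring_nf

lemma besselK_pos (ν : ℝ) {z : ℝ} (hz : 0 < z) : 0 < besselK ν z := by
  refine (setIntegral_pos_iff_support_of_nonneg_ae (ae_of_all _ fun θ => by positivity)
    (integrableOn_besselK ν hz)).2 ?_
  have : Function.support
      (fun θ : ℝ => Real.cosh (ν * θ) * Real.exp (-z * Real.cosh θ)) = univ := by
    ext θ
    simp [(Real.cosh_pos (ν * θ)).ne']
  rw [this]
  simp

lemma besselK_mono {μ ν : ℝ} (hμ : 0 ≤ μ) (h : μ ≤ ν) {z : ℝ} (hz : 0 < z) :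
    besselK μ z ≤ besselK ν z := by
  refine setIntegral_mono_on (integrableOn_besselK μ hz) (integrableOn_besselK ν hz)
    measurableSet_Ioi fun θ hθ => ?_
  have hθ' : (0 : ℝ) < θ := hθ
  gcongr
  rw [Real.cosh_le_cosh, abs_of_nonneg (by positivity), abs_of_nonneg (by nlinarith)]
  gcongr

lemma besselK_le_exp (ν : ℝ) {z : ℝ} (hz : 1 ≤ z) :
    besselK ν z ≤ Real.exp (-(z - 1)) * besselK ν 1 := by
  unfold besselK
  rw [← integral_const_mul]
  refine setIntegral_mono_on (integrableOn_besselK ν (by linarith))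
    ((integrableOn_besselK ν one_pos).const_mul _) measurableSet_Ioi fun θ _ => ?_
  rw [mul_left_comm, ← Real.exp_add]
  gcongr
  nlinarith [Real.one_le_cosh θ]

lemma tendsto_besselK_atTop (ν : ℝ) : Tendsto (besselK ν) atTop (𝓝 0) := by
  have h : Tendsto (fun z : ℝ => Real.exp (-(z - 1)) * besselK ν 1) atTop (𝓝 (0 * besselK ν 1)) :=
    (Real.tendsto_exp_neg_atTop_nhds_zero.comp
      (tendsto_atTop_add_const_right _ (-1) tendsto_id)).mul_const _
  rw [zero_mul] at h
  refine tendsto_of_tendsto_of_tendsto_of_le_of_le' tendsto_const_nhds h ?_ ?_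
  · filter_upwards [eventually_gt_atTop 0] with z hz using (besselK_pos ν hz).le
  · filter_upwards [eventually_ge_atTop 1] with z hz using besselK_le_exp ν hz

lemma cosh_mul_cosh (ν θ : ℝ) :
    Real.cosh θ * Real.cosh (ν * θ) =
      (Real.cosh ((ν + 1) * θ) + Real.cosh ((ν - 1) * θ)) / 2 := by
  rw [add_mul, sub_mul, one_mul, Real.cosh_add, Real.cosh_sub]
  ring

lemma hasDerivAt_besselK (ν : ℝ) {z : ℝ} (hz : 0 < z) :
    HasDerivAt (besselK ν) (-(besselK (ν + 1) z + besselK (ν - 1) z) / 2) z := by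
  have hint : ∀ x : ℝ, 0 < x → IntegrableOn
      (fun θ : ℝ => Real.cosh θ * Real.cosh (ν * θ) * Real.exp (-x * Real.cosh θ)) (Ioi 0) := by
    intro x hx
    refine (((integrableOn_besselK (ν + 1) hx).add (integrableOn_besselK (ν - 1) hx)).div_const
      2).congr (ae_of_all _ fun θ => ?_)
    simp only [Pi.add_apply, cosh_mul_cosh]
    ring
  have key := (hasDerivAt_integral_of_dominated_loc_of_deriv_le (μ := volume.restrict (Ioi 0))
    (F := fun x θ => Real.cosh (ν * θ) * Real.exp (-x * Real.cosh θ))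
    (F' := fun x θ => -(Real.cosh θ * Real.cosh (ν * θ) * Real.exp (-x * Real.cosh θ)))
    (bound := fun θ => Real.cosh θ * Real.cosh (ν * θ) * Real.exp (-(z / 2) * Real.cosh θ))
    (x₀ := z) (s := Ioi (z / 2)) (Ioi_mem_nhds (by linarith))
    (.of_forall fun x => (by fun_prop : Continuous _).aestronglyMeasurable)
    (integrableOn_besselK ν hz) (by fun_prop : Continuous _).aestronglyMeasurable
    (ae_of_all _ fun θ x hx => ?_) (hint _ (by positivity)) (ae_of_all _ fun θ x _ => ?_)).2
  · refine key.congr_deriv ?_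
    have : ∀ θ : ℝ, -(Real.cosh θ * Real.cosh (ν * θ) * Real.exp (-z * Real.cosh θ)) =
        (-1 / 2) * (Real.cosh ((ν + 1) * θ) * Real.exp (-z * Real.cosh θ) +
          Real.cosh ((ν - 1) * θ) * Real.exp (-z * Real.cosh θ)) := by
      intro θ
      rw [cosh_mul_cosh]
      ring
    simp only [this]
    rw [integral_const_mul, integral_add (integrableOn_besselK (ν + 1) hz)
      (integrableOn_besselK (ν - 1) hz)]
    unfold besselK
    ring
  · have hx' : z / 2 < x := hx
    rw [norm_neg, Real.norm_of_nonneg (by positivity)]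
    gcongr
  · have h : HasDerivAt (fun x : ℝ => -x * Real.cosh θ) (-1 * Real.cosh θ) x :=
      (hasDerivAt_neg x).mul_const _
    refine (h.exp.const_mul (Real.cosh (ν * θ))).congr_deriv ?_
    ring

/-- The recurrence relation, obtained by integrating `d/dϑ (sinh (ν ϑ) exp (-z cosh ϑ))`. -/
lemma besselK_succ_sub_pred (ν : ℝ) {z : ℝ} (hz : 0 < z) :
    z * (besselK (ν + 1) z - besselK (ν - 1) z) = 2 * ν * besselK ν z := by
  have h12 : IntegrableOn (fun θ : ℝ => Real.cosh ((ν + 1) * θ) * Real.exp (-z * Real.cosh θ) -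
      Real.cosh ((ν - 1) * θ) * Real.exp (-z * Real.cosh θ)) (Ioi 0) :=
    (integrableOn_besselK (ν + 1) hz).sub (integrableOn_besselK (ν - 1) hz)
  have h0 := (integrableOn_besselK ν hz).const_mul ν
  have h := integral_Ioi_of_hasDerivAt_of_tendsto' (a := 0) (m := 0)
    (f := fun θ => Real.sinh (ν * θ) * Real.exp (-z * Real.cosh θ)) (fun θ _ => ?_)
    (h0.sub (h12.const_mul (z / 2))) (tendsto_sinh_mul_exp_neg_cosh ν hz)
  · simp only [Pi.sub_apply] at h
    rw [integral_sub h0 (h12.const_mul (z / 2)),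
      integral_const_mul, integral_const_mul, integral_sub (integrableOn_besselK (ν + 1) hz)
      (integrableOn_besselK (ν - 1) hz)] at h
    simp only [mul_zero, Real.sinh_zero, zero_mul, sub_zero] at h
    unfold besselK
    linarith
  · have h1 : HasDerivAt (fun θ : ℝ => Real.sinh (ν * θ)) (Real.cosh (ν * θ) * (ν * 1)) θ :=
      ((hasDerivAt_id θ).const_mul ν).sinh
    have h2 : HasDerivAt (fun θ : ℝ => Real.exp (-z * Real.cosh θ))
        (Real.exp (-z * Real.cosh θ) * (-z * Real.sinh θ)) θ :=
      ((Real.hasDerivAt_cosh θ).const_mul (-z)).exp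
    refine (h1.mul h2).congr_deriv ?_
    rw [Pi.sub_apply, add_mul, sub_mul, one_mul, Real.cosh_add, Real.cosh_sub]
    ring

lemma besselK_three {z : ℝ} (hz : 0 < z) :
    z * besselK 3 z = z * besselK 1 z + 4 * besselK 2 z := by
  have h := besselK_succ_sub_pred 2 hz
  norm_num at h
  linarith

lemma hasDerivAt_besselK_two {z : ℝ} (hz : 0 < z) :
    HasDerivAt (besselK 2) (-besselK 3 z + 2 * besselK 2 z / z) z := by
  convert hasDerivAt_besselK 2 hz using 1
  have h := besselK_three hz
  norm_num
  field_simp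
  linarith

lemma hasDerivAt_besselK_three {z : ℝ} (hz : 0 < z) :
    HasDerivAt (besselK 3) (-besselK 2 z - 3 * besselK 3 z / z) z := by
  convert hasDerivAt_besselK 3 hz using 1
  have h := besselK_succ_sub_pred 3 hz
  norm_num at h ⊢
  field_simp
  linarith

/-! ### The enthalpy function `G` and the isobaric specific heat -/

lemma mul_G_eq {z : ℝ} (hz : 0 < z) :
    z * G z = 4 + z * (besselK 1 z / besselK 2 z) := by
  have h2 := besselK_pos 2 hz
  have h := besselK_three hz
  unfold G
  field_simp
  linarith

lemma four_lt_mul_G {z : ℝ} (hz : 0 < z) : 4 < z * G z := by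
  have h1 := besselK_pos 1 hz
  have h2 := besselK_pos 2 hz
  have : 0 < z * (besselK 1 z / besselK 2 z) := by positivity
  linarith [mul_G_eq hz]

lemma mul_G_le {z : ℝ} (hz : 0 < z) : z * G z ≤ 4 + z := by
  have h : besselK 1 z / besselK 2 z ≤ 1 :=
    (div_le_one (besselK_pos 2 hz)).2 (besselK_mono (by norm_num) (by norm_num) hz)
  rw [mul_G_eq hz]
  nlinarith

lemma G_pos {z : ℝ} (hz : 0 < z) : 0 < G z :=
  div_pos (besselK_pos 3 hz) (besselK_pos 2 hz)

/-- The specific heat at constant pressure, `dh/dT = -ζ² G'(ζ)`, written as a polynomial in `ζ` and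
`ζ G(ζ)` by means of the Riccati equation `G' = G² - 5 G / ζ - 1`. -/
def specificHeat (z : ℝ) : ℝ := 5 * (z * G z) + z ^ 2 - (z * G z) ^ 2

lemma hasDerivAt_G {z : ℝ} (hz : 0 < z) : HasDerivAt G (-specificHeat z / z ^ 2) z := by
  have h2 := besselK_pos 2 hz
  refine ((hasDerivAt_besselK_three hz).div (hasDerivAt_besselK_two hz) h2.ne').congr_deriv ?_
  unfold specificHeat G
  field_simp
  ring

lemma hasDerivAt_mul_G {z : ℝ} (hz : 0 < z) :
    HasDerivAt (fun x => x * G x) ((z * G z - specificHeat z) / z) z := by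
  refine ((hasDerivAt_id z).mul (hasDerivAt_G hz)).congr_deriv ?_
  simp only [id]
  field_simp
  ring

lemma hasDerivAt_specificHeat {z : ℝ} (hz : 0 < z) :
    HasDerivAt specificHeat
      ((2 * (z * G z) * specificHeat z - 5 * (z * G z) - 3 * specificHeat z) / z) z := by
  have hg := hasDerivAt_mul_G hz
  refine (((hg.const_mul 5).add (hasDerivAt_pow 2 z)).sub (hg.pow 2)).congr_deriv ?_
  unfold specificHeat
  field_simp
  ring

/-- The specific heat at constant pressure exceeds its non-relativistic limit `5/2`. The function
`(5/2 - c_p) K₂² / ζ` has the positive derivative `(15/2) K₂² / ζ²`; it is bounded above by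
`3 K₂²`, which tends to zero at infinity, so it is negative everywhere. -/
lemma specificHeat_gt {z : ℝ} (hz : 0 < z) : 5 / 2 < specificHeat z := by
  set Q : ℝ → ℝ := fun x => (5 / 2 - specificHeat x) * besselK 2 x ^ 2 / x with hQ
  have hderiv : ∀ x : ℝ, 0 < x → HasDerivAt Q (15 / 2 * besselK 2 x ^ 2 / x ^ 2) x := by
    intro x hx
    have h2 := besselK_pos 2 hx
    refine ((((hasDerivAt_specificHeat hx).const_sub (5 / 2)).mul
      ((hasDerivAt_besselK_two hx).pow 2)).div (hasDerivAt_id x) hx.ne').congr_deriv ?_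
    have hG : besselK 3 x = G x * besselK 2 x := by
      unfold G
      field_simp
    simp only [hG, id, Pi.pow_apply, Pi.mul_apply]
    field_simp
    ring
  have hmono : StrictMonoOn Q (Ioi 0) := by
    refine strictMonoOn_of_deriv_pos (convex_Ioi 0)
      (fun x hx => (hderiv x hx).continuousAt.continuousWithinAt) fun x hx => ?_
    rw [interior_Ioi] at hx
    have hx : 0 < x := hx
    rw [(hderiv x hx).deriv]
    have h2 := besselK_pos 2 hx
    positivity
  have hle : ∀ x : ℝ, 0 < x → Q x ≤ 3 * besselK 2 x ^ 2 := by
    intro x hx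
    have h4 := four_lt_mul_G hx
    have h5 := mul_G_le hx
    have hb : 5 / 2 - specificHeat x ≤ 3 * x := by
      unfold specificHeat
      nlinarith
    rw [hQ, div_le_iff₀ hx]
    nlinarith [sq_nonneg (besselK 2 x)]
  have hlim : Tendsto (fun x => 3 * besselK 2 x ^ 2) atTop (𝓝 0) := by
    simpa using ((tendsto_besselK_atTop 2).pow 2).const_mul 3
  have hz1 : Q (z + 1) ≤ 0 := by
    refine ge_of_tendsto hlim ?_
    filter_upwards [eventually_ge_atTop (z + 1)] with x hx
    have hx0 : 0 < x := by linarith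
    exact (hmono.monotoneOn (show z + 1 ∈ Ioi (0 : ℝ) by simp; linarith) hx0 hx).trans (hle x hx0)
  have hneg : Q z < 0 :=
    (hmono hz (show z + 1 ∈ Ioi (0 : ℝ) by simp; linarith) (by linarith)).trans_le hz1
  have h2 := besselK_pos 2 hz
  by_contra! hcon
  have : 0 ≤ Q z := div_nonneg (mul_nonneg (by linarith) (by positivity)) hz.le
  linarith

lemma strictAntiOn_G : StrictAntiOn G (Ioi 0) := by
  refine strictAntiOn_of_deriv_neg (convex_Ioi 0)
    (fun x hx => (hasDerivAt_G hx).continuousAt.continuousWithinAt) fun x hx => ?_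
  rw [interior_Ioi] at hx
  have hx : 0 < x := hx
  rw [(hasDerivAt_G hx).deriv]
  have := specificHeat_gt hx
  exact div_neg_of_neg_of_pos (by linarith) (by positivity)

/-! ### The speed of sound and genuine nonlinearity -/

/-- The inverse square `c_s⁻²` of the speed of sound as a function of the coldness. -/
def invSqSound (z : ℝ) : ℝ := z * G z * (specificHeat z - 1) / specificHeat z

lemma one_lt_invSqSound {z : ℝ} (hz : 0 < z) : 1 < invSqSound z := by
  have h1 := four_lt_mul_G hz
  have h2 := specificHeat_gt hz
  rw [invSqSound, one_lt_div (by linarith)]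
  nlinarith

lemma soundSpeed_eq {ρ p : ℝ} (hρ : 0 < ρ) (hp : 0 < p) :
    soundSpeed ρ p = (Real.sqrt (invSqSound (ρ / p)))⁻¹ := by
  have hz : 0 < ρ / p := by positivity
  have ha := specificHeat_gt hz
  have hg := four_lt_mul_G hz
  have hG := G_pos hz
  have hE : HasDerivAt (fun z => G z - z⁻¹ - 1)
      (-specificHeat (ρ / p) / (ρ / p) ^ 2 - -((ρ / p) ^ 2)⁻¹) (ρ / p) :=
    ((hasDerivAt_G hz).sub (hasDerivAt_inv hz.ne')).sub_const 1
  have h1 : HasDerivAt (fun r => internalEnergy r p) _ ρ :=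
    HasDerivAt.comp ρ (h := fun r => r / p) hE ((hasDerivAt_id ρ).div_const p)
  have h2 : HasDerivAt (fun q => internalEnergy ρ q) _ p :=
    HasDerivAt.comp p (h := fun q => ρ / q) hE
      ((hasDerivAt_const p ρ).div (hasDerivAt_id p) hp.ne')
  rw [soundSpeed, h1.deriv, h2.deriv, ← Real.sqrt_inv, enthalpy, zeta, invSqSound]
  congr 1
  set a := specificHeat (ρ / p)
  have ha1 : a - 1 ≠ 0 := by linarith
  have ha0 : a ≠ 0 := by linarith
  have hp0 := hp.ne'
  have hρ0 := hρ.ne'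
  have hG0 := hG.ne'
  have e1 : p / ρ ^ 2 - (-a / (ρ / p) ^ 2 - -((ρ / p) ^ 2)⁻¹) * (1 / p) = a * p / ρ ^ 2 := by
    field_simp
    ring
  have e2 : G (ρ / p) * ((-a / (ρ / p) ^ 2 - -((ρ / p) ^ 2)⁻¹) * ((0 * p - ρ * 1) / p ^ 2)) =
      G (ρ / p) * (a - 1) / ρ := by
    field_simp
    ring
  rw [e1, e2]
  field_simp

lemma hasDerivAt_invSqSound {z : ℝ} (hz : 0 < z) :
    HasDerivAt invSqSound (((z * G z - specificHeat z) * (specificHeat z - 1) * specificHeat z +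
      z * G z * (2 * (z * G z) * specificHeat z - 5 * (z * G z) - 3 * specificHeat z)) /
        (z * specificHeat z ^ 2)) z := by
  have ha : specificHeat z ≠ 0 := by linarith [specificHeat_gt hz]
  refine (((hasDerivAt_mul_G hz).mul ((hasDerivAt_specificHeat hz).sub_const 1)).div
    (hasDerivAt_specificHeat hz) ha).congr_deriv ?_
  simp only [Pi.mul_apply]
  field_simp
  ring

/-- Genuine nonlinearity of the acoustic fields: the isentropes are strictly convex in the plane
of the pressure and the dynamical volume `h / ρ`. In terms of `g = ζ G` and the specific heat `a`
the claim is `g (2a + 1)(a - 2) / a + g² (2a - 5) / a² > 3 (a - 1)`, which follows from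
`g > 4` and `a > 5/2`. -/
lemma genuinely_nonlinear {z : ℝ} (hz : 0 < z) :
    0 < z * deriv invSqSound z + 2 * (invSqSound z - 1) * (specificHeat z - 1) := by
  rw [(hasDerivAt_invSqSound hz).deriv, invSqSound]
  have hg := four_lt_mul_G hz
  have ha := specificHeat_gt hz
  set g := z * G z
  set a := specificHeat z
  have ha0 : a ≠ 0 := by linarith
  have key : z * (((g - a) * (a - 1) * a + g * (2 * g * a - 5 * g - 3 * a)) / (z * a ^ 2)) +
      2 * (g * (a - 1) / a - 1) * (a - 1) =
      (a * (g * (2 * a + 1) * (a - 2) - 3 * a * (a - 1)) + g ^ 2 * (2 * a - 5)) / a ^ 2 := by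
    field_simp
    ring
  rw [key]
  have h1 : 0 < g * (2 * a + 1) * (a - 2) - 3 * a * (a - 1) := by
    have : 0 < (g - 4) * ((2 * a + 1) * (a - 2)) :=
      mul_pos (by linarith) (mul_pos (by linarith) (by linarith))
    nlinarith
  have h2 : 0 < g ^ 2 * (2 * a - 5) := mul_pos (by positivity) (by linarith)
  have h3 : 0 < a := by linarith
  positivity

/-! ### Isentropes -/

/-- The pressure along an isentrope, up to a constant factor, as a function of the coldness. -/
def isentropicPressure (z : ℝ) : ℝ := Real.exp (z * G z + Real.log (besselK 2 z) - 2 * Real.log z)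

lemma isentropicPressure_pos (z : ℝ) : 0 < isentropicPressure z := Real.exp_pos _

lemma hasDerivAt_isentropicPressure {z : ℝ} (hz : 0 < z) :
    HasDerivAt isentropicPressure (-isentropicPressure z * specificHeat z / z) z := by
  have h2 := besselK_pos 2 hz
  refine (((hasDerivAt_mul_G hz).add ((hasDerivAt_besselK_two hz).log h2.ne')).sub
    ((Real.hasDerivAt_log hz.ne').const_mul 2)).exp.congr_deriv ?_
  change isentropicPressure z * _ = _
  have hG : besselK 3 z = G z * besselK 2 z := by
    unfold G
    field_simp
  rw [hG]
  field_simp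
  ring

/-- The specific heat exceeds one, so that `ζ` times the pressure decreases along an isentrope. -/
lemma tendsto_isentropicPressure : Tendsto isentropicPressure atTop (𝓝 0) := by
  have hanti : AntitoneOn (fun z => z * isentropicPressure z) (Ioi 0) := by
    have hd : ∀ z : ℝ, 0 < z → HasDerivAt (fun z => z * isentropicPressure z)
        (isentropicPressure z * (1 - specificHeat z)) z := by
      intro z hz
      refine ((hasDerivAt_id z).mul (hasDerivAt_isentropicPressure hz)).congr_deriv ?_
      simp only [id]
      field_simp
      ring
    refine antitoneOn_of_deriv_nonpos (convex_Ioi 0)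
      (fun x hx => (hd x hx).continuousAt.continuousWithinAt)
      (fun x hx => (hd x (interior_subset hx)).differentiableAt.differentiableWithinAt)
      fun x hx => ?_
    have hx : 0 < x := interior_subset hx
    rw [(hd x hx).deriv]
    nlinarith [specificHeat_gt hx, isentropicPressure_pos x]
  have h0 : Tendsto (fun z : ℝ => isentropicPressure 1 * z⁻¹) atTop (𝓝 0) := by
    simpa using tendsto_inv_atTop_zero.const_mul (isentropicPressure 1)
  refine tendsto_of_tendsto_of_tendsto_of_le_of_le' tendsto_const_nhds h0
    (.of_forall fun z => (isentropicPressure_pos z).le) ?_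
  filter_upwards [eventually_ge_atTop 1] with z hz
  have hz0 : 0 < z := by linarith
  have := hanti (show (1 : ℝ) ∈ Ioi 0 by simp) hz0 hz
  rw [← div_eq_mul_inv, le_div_iff₀ hz0]
  simpa [mul_comm] using this

/-! ### The Taub adiabat -/

/-- Consider two states that satisfy the Taub relation, with `h / ρ` decreasing from the first to
the second at the rate `m` with respect to the pressure. If it decreases faster than that along the
isentrope at the first state, as it does for a supersonic inflow, then the pressure cannot drop.
Otherwise, by convexity, the isentrope through the first state stays above the chord down to the
pressure `p_r`. The point that it reaches there has a larger `h / ρ` than the second state, hence a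
smaller coldness, but, by integration of `d(h²) = 2 (h / ρ) dp`, a smaller enthalpy, hence a larger
coldness. -/
lemma pressure_le_of_taub {ρl pl ρr pr m : ℝ} (hρl : 0 < ρl) (hpl : 0 < pl) (hρr : 0 < ρr)
    (hpr : 0 < pr)
    (hchord : G (ρr / pr) / ρr - G (ρl / pl) / ρl = -m * (pr - pl))
    (htaub : G (ρr / pr) ^ 2 - G (ρl / pl) ^ 2 =
      (pr - pl) * (G (ρl / pl) / ρl + G (ρr / pr) / ρr))
    (hsuper : m < (invSqSound (ρl / pl) - 1) / ρl ^ 2) : pl ≤ pr := by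
  by_contra! hlt
  have hzl : 0 < ρl / pl := by positivity
  have hzr : 0 < ρr / pr := by positivity
  have hρl' : ρl = ρl / pl * pl := by field_simp
  have hρr' : ρr = ρr / pr * pr := by field_simp
  set zl := ρl / pl
  set zr := ρr / pr
  -- The isentrope through the first state, parametrized by the coldness.
  set P : ℝ → ℝ := fun z => pl / isentropicPressure zl * isentropicPressure z with hPdef
  have hPpos : ∀ z, 0 < P z := fun z =>
    mul_pos (div_pos hpl (isentropicPressure_pos _)) (isentropicPressure_pos _)
  have hPl : P zl = pl := div_mul_cancel₀ _ (isentropicPressure_pos zl).ne'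
  have hP : ∀ z, 0 < z → HasDerivAt P (-P z * specificHeat z / z) z := fun z hz =>
    ((hasDerivAt_isentropicPressure hz).const_mul _).congr_deriv (by rw [hPdef]; ring)
  obtain ⟨w, hw, hPw⟩ : ∃ w, zl < w ∧ P w = pr := by
    have hlim : Tendsto P atTop (𝓝 0) := by
      simpa using tendsto_isentropicPressure.const_mul (pl / isentropicPressure zl)
    obtain ⟨b, hb, hzb⟩ :=
      ((hlim.eventually (gt_mem_nhds hpr)).and (eventually_ge_atTop zl)).exists
    obtain ⟨w, hw, hPw⟩ := intermediate_value_Icc' hzb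
      (fun x hx => (hP x (hzl.trans_le hx.1)).continuousAt.continuousWithinAt)
      (show pr ∈ Icc (P b) (P zl) from ⟨hb.le, hPl ▸ hlt.le⟩)
    refine ⟨w, lt_of_le_of_ne hw.1 ?_, hPw⟩
    rintro rfl
    linarith
  -- Convexity of the isentrope: minus its slope, as a function of the pressure, increases with `z`.
  set Φ : ℝ → ℝ := fun z => (invSqSound z - 1) / (z * P z) ^ 2 with hΦdef
  have hΦ : StrictMonoOn Φ (Ioi 0) := by
    have hd : ∀ z, 0 < z → HasDerivAt Φ
        ((z * deriv invSqSound z + 2 * (invSqSound z - 1) * (specificHeat z - 1)) /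
          (z * (z * P z) ^ 2)) z := by
      intro z hz
      have hPz := hPpos z
      have hne : (z * P z) ^ 2 ≠ 0 := by positivity
      refine (((hasDerivAt_invSqSound hz).differentiableAt.hasDerivAt.sub_const 1).div
        (((hasDerivAt_id z).mul (hP z hz)).pow 2) hne).congr_deriv ?_
      simp only [id, Pi.mul_apply, Pi.pow_apply]
      field_simp
      ring
    refine strictMonoOn_of_deriv_pos (convex_Ioi 0)
      (fun x hx => (hd x hx).continuousAt.continuousWithinAt) fun x hx => ?_
    have hx : 0 < x := interior_subset hx
    rw [(hd x hx).deriv]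
    have h1 := genuinely_nonlinear hx
    have h2 := hPpos x
    positivity
  -- Height of the isentrope above the chord.
  set f : ℝ → ℝ := fun z => G z / (z * P z) - G zl / ρl + m * (P z - pl) with hfdef
  have hfd : ∀ z, 0 < z → HasDerivAt f (P z * specificHeat z / z * (Φ z - m)) z := by
    intro z hz
    have hPz := hPpos z
    have ha : specificHeat z ≠ 0 := by linarith [specificHeat_gt hz]
    have hne : z * P z ≠ 0 := by positivity
    refine ((((hasDerivAt_G hz).div ((hasDerivAt_id z).mul (hP z hz)) hne).sub_const _).add
      (((hP z hz).sub_const pl).const_mul m)).congr_deriv ?_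
    rw [hΦdef]
    simp only [id, Pi.mul_apply, invSqSound]
    field_simp
    ring
  have hf : StrictMonoOn f (Ici zl) := by
    refine strictMonoOn_of_deriv_pos (convex_Ici zl)
      (fun x hx => (hfd x (hzl.trans_le hx)).continuousAt.continuousWithinAt) fun x hx => ?_
    rw [interior_Ici] at hx
    have hx : zl < x := hx
    have hx0 : 0 < x := hzl.trans hx
    rw [(hfd x hx0).deriv]
    have h1 := hΦ hzl hx0 hx
    have h2 : Φ zl = (invSqSound zl - 1) / ρl ^ 2 := by simp only [hΦdef, hPl, ← hρl']
    have h3 := hPpos x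
    have h4 := specificHeat_gt hx0
    exact mul_pos (div_pos (mul_pos h3 (by linarith)) hx0) (by linarith)
  have hfl : f zl = 0 := by simp only [hfdef, hPl, ← hρl']; ring
  -- Excess of the squared enthalpy along the isentrope over its Taub value along the chord.
  set k : ℝ → ℝ := fun z =>
    G z ^ 2 - (P z - pl) * (2 * (G zl / ρl) - m * (P z - pl)) with hkdef
  have hkd : ∀ z, 0 < z → HasDerivAt k (2 * (-P z * specificHeat z / z) * f z) z := by
    intro z hz
    have hPz := hPpos z
    refine (((hasDerivAt_G hz).pow 2).sub (((hP z hz).sub_const pl).mul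
      ((((hP z hz).sub_const pl).const_mul m).const_sub _))).congr_deriv ?_
    rw [hfdef]
    field_simp
    ring
  have hk : StrictAntiOn k (Ici zl) := by
    refine strictAntiOn_of_deriv_neg (convex_Ici zl)
      (fun x hx => (hkd x (hzl.trans_le hx)).continuousAt.continuousWithinAt) fun x hx => ?_
    rw [interior_Ici] at hx
    have hx : zl < x := hx
    have hx0 : 0 < x := hzl.trans hx
    rw [(hkd x hx0).deriv]
    have h1 := hf self_mem_Ici hx.le hx
    have h2 : 0 < P x * specificHeat x / x :=
      div_pos (mul_pos (hPpos x) (by linarith [specificHeat_gt hx0])) hx0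
    have h3 : -P x * specificHeat x / x = -(P x * specificHeat x / x) := by ring
    rw [h3]
    nlinarith
  have hkl : k zl = G zl ^ 2 := by simp only [hkdef, hPl]; ring
  have hw0 : 0 < w := hzl.trans hw
  have hfw := hf self_mem_Ici hw.le hw
  have hkw := hk self_mem_Ici hw.le hw
  have hGw := G_pos hw0
  have hGr := G_pos hzr
  have hvol : G zr / ρr < G w / (w * pr) := by
    rw [hfl, hfdef] at hfw
    simp only [hPw] at hfw
    linarith
  have henth : G w < G zr := by
    rw [hkl, hkdef] at hkw
    simp only [hPw] at hkw
    have e : G zr / ρr = G zl / ρl - m * (pr - pl) := by linarith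
    rw [e] at htaub
    exact lt_of_pow_lt_pow_left₀ 2 hGr.le (by linarith)
  have hzw : zr < w := (strictAntiOn_G.lt_iff_gt hw0 hzr).1 henth
  have : G w / (w * pr) < G zr / ρr := by
    rw [hρr']
    gcongr
  linarith

/-! ### Kinematics -/

namespace FluidState

lemma Admissible.sq_lt {V : FluidState} (hV : V.Admissible) : 0 < 1 - V.u ^ 2 := by
  have := (sq_lt_one_iff_abs_lt_one V.u).2 hV.2.2
  linarith

lemma Admissible.U0_pos {V : FluidState} (hV : V.Admissible) : 0 < V.U0 :=
  one_div_pos.2 (Real.sqrt_pos.2 hV.sq_lt)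

lemma Admissible.U0_sq {V : FluidState} (hV : V.Admissible) : V.U0 ^ 2 * (1 - V.u ^ 2) = 1 := by
  rw [U0, div_pow, Real.sq_sqrt hV.sq_lt.le, one_pow, one_div_mul_cancel hV.sq_lt.ne']

lemma Admissible.zeta_pos {V : FluidState} (hV : V.Admissible) : 0 < V.ρ / V.p :=
  div_pos hV.1 hV.2.1

lemma Admissible.h_pos {V : FluidState} (hV : V.Admissible) : 0 < V.h := G_pos hV.zeta_pos

lemma Admissible.cs_pos {V : FluidState} (hV : V.Admissible) : 0 < V.cs := by
  rw [cs, soundSpeed_eq hV.1 hV.2.1]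
  have := one_lt_invSqSound hV.zeta_pos
  exact inv_pos.2 (Real.sqrt_pos.2 (by linarith))

lemma Admissible.cs_sq {V : FluidState} (hV : V.Admissible) :
    V.cs ^ 2 * invSqSound (V.ρ / V.p) = 1 := by
  have := one_lt_invSqSound hV.zeta_pos
  rw [cs, soundSpeed_eq hV.1 hV.2.1, inv_pow, Real.sq_sqrt (by linarith),
    inv_mul_cancel₀ (by linarith)]

lemma Admissible.cs_lt_one {V : FluidState} (hV : V.Admissible) : V.cs < 1 := by
  have h1 := one_lt_invSqSound hV.zeta_pos
  have h2 := hV.cs_sq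
  have h3 := hV.cs_pos
  by_contra! h
  have h4 : 1 ≤ V.cs ^ 2 := one_le_pow₀ h
  nlinarith

lemma Admissible.one_sub_pos {V : FluidState} (hV : V.Admissible) : 0 < 1 - V.u * V.cs := by
  have h := abs_lt.1 hV.2.2
  nlinarith [hV.cs_pos, hV.cs_lt_one]

lemma Admissible.abs_lambdaMinus_lt {V : FluidState} (hV : V.Admissible) :
    |V.lambdaMinus| < 1 := by
  have h := abs_lt.1 hV.2.2
  have h1 := hV.cs_pos
  have h2 := hV.cs_lt_one
  rw [abs_lt, lambdaMinus, lt_div_iff₀ hV.one_sub_pos, div_lt_one hV.one_sub_pos]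
  constructor <;> nlinarith

end FluidState

/-- The Rankine-Hugoniot conditions in terms of the mass flux `ρ U⁰ (u - s)` across the
discontinuity. -/
lemma RankineHugoniot.fluxes {s : ℝ} {l r : FluidState} (H : RankineHugoniot s l r) :
    r.ρ * r.U0 * (r.u - s) = l.ρ * l.U0 * (l.u - s) ∧
    r.ρ * r.U0 * (r.u - s) * (r.h * r.U0 * r.u) + r.p =
      l.ρ * l.U0 * (l.u - s) * (l.h * l.U0 * l.u) + l.p ∧
    r.ρ * r.U0 * (r.u - s) * (r.h * r.U0) + s * r.p =
      l.ρ * l.U0 * (l.u - s) * (l.h * l.U0) + s * l.p := by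
  have h0 := congrFun H 0
  have h1 := congrFun H 1
  have h2 := congrFun H 2
  simp only [FluidState.W, FluidState.F, FluidState.U1, Pi.smul_apply, Pi.sub_apply, smul_eq_mul,
    Matrix.cons_val] at h0 h1 h2
  refine ⟨?_, ?_, ?_⟩ <;> linarith

/-! ### Contact discontinuities and shocks -/

lemma IsContact.eq {l r : FluidState} (hl : l.Admissible) (hr : r.Admissible)
    (H : IsContact l r) : l.p = r.p ∧ l.u = r.u := by
  obtain ⟨s, hRH, hs⟩ := H
  obtain ⟨h0, h1, -⟩ := hRH.fluxes
  have hml := mul_pos hl.1 hl.U0_pos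
  have hmr := mul_pos hr.1 hr.U0_pos
  have key : l.u - s = 0 ∧ r.u - s = 0 := by
    rcases hs with hs | hs <;> simp only [FluidState.lambdaZero] at hs <;> subst hs
    · simp only [sub_self, mul_zero, mul_eq_zero, hmr.ne', false_or] at h0
      exact ⟨sub_self _, h0⟩
    · have h0 := h0.symm
      simp only [sub_self, mul_zero, mul_eq_zero, hml.ne', false_or] at h0
      exact ⟨h0, sub_self _⟩
  rw [key.1, key.2] at h1
  simp only [mul_zero, zero_mul, zero_add] at h1
  exact ⟨h1.symm, by linarith [key.1, key.2]⟩

/-- In the frame of the discontinuity the flow is supersonic on a side where `s < λ_-`. With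
the relative velocity `v = (u - s) / (1 - u s)` the second claim reads
`c_s² / (1 - c_s²) < v² / (1 - v²)`. -/
lemma FluidState.Admissible.supersonic {V : FluidState} (hV : V.Admissible) {s : ℝ}
    (hs : |s| < 1) (h : s < V.lambdaMinus) :
    s < V.u ∧ (1 - s ^ 2) * V.ρ ^ 2 <
      (invSqSound (V.ρ / V.p) - 1) * (V.ρ * V.U0 * (V.u - s)) ^ 2 := by
  have hs1 := abs_lt.1 hs
  have hu := abs_lt.1 hV.2.2
  have hd : 0 < 1 - V.u * s := by nlinarith
  have hc := hV.cs_pos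
  have hU := hV.U0_pos
  have hρ := hV.1
  have hR := one_lt_invSqSound hV.zeta_pos
  have hcR := hV.cs_sq
  have hsup : V.cs * (1 - V.u * s) < V.u - s := by
    rw [FluidState.lambdaMinus, lt_div_iff₀ hV.one_sub_pos] at h
    linarith
  refine ⟨by linarith [mul_pos hc hd], ?_⟩
  set R := invSqSound (V.ρ / V.p)
  have h3 : V.cs ^ 2 * (1 - V.u * s) ^ 2 < (V.u - s) ^ 2 := by
    rw [← mul_pow]
    exact pow_lt_pow_left₀ hsup (by positivity) two_ne_zero
  have h5 : (1 - V.u * s) ^ 2 < (V.u - s) ^ 2 * R := by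
    have := mul_lt_mul_of_pos_right h3 (show 0 < R by linarith)
    linear_combination this - (1 - V.u * s) ^ 2 * hcR
  have h6 := mul_lt_mul_of_pos_left h5 (show 0 < V.ρ ^ 2 * V.U0 ^ 2 by positivity)
  linear_combination h6 - V.ρ ^ 2 * (1 - s ^ 2) * hV.U0_sq

/-- A discontinuity with nonzero mass flux and without a pressure jump is trivial. -/
lemma RankineHugoniot.eq_of_pressure_eq {s : ℝ} {l r : FluidState} (hl : l.Admissible)
    (H : RankineHugoniot s l r) (hs : s < l.u) (hp : l.p = r.p) : r = l := by
  obtain ⟨h0, h1, h2⟩ := H.fluxes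
  have hv : l.u - s ≠ 0 := by linarith
  have hU := hl.U0_pos.ne'
  have hJ : l.ρ * l.U0 * (l.u - s) ≠ 0 := mul_ne_zero (mul_ne_zero hl.1.ne' hU) hv
  rw [h0, hp] at h1 h2
  have hB : r.h * r.U0 = l.h * l.U0 := mul_left_cancel₀ hJ (by linarith)
  have hA : r.h * r.U0 * r.u = l.h * l.U0 * l.u := mul_left_cancel₀ hJ (by linarith)
  have hu : r.u = l.u := by
    rw [hB] at hA
    exact mul_left_cancel₀ (mul_ne_zero hl.h_pos.ne' hU) hA
  have hUU : r.U0 = l.U0 := by simp only [FluidState.U0, hu]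
  have hρ : r.ρ = l.ρ := by
    rw [hu, hUU] at h0
    exact mul_right_cancel₀ hU (mul_right_cancel₀ hv h0)
  cases l
  cases r
  simp_all

lemma isShock_lambdaMinus {l r : FluidState} (hl : l.Admissible) (hr : r.Admissible)
    (H : IsShock FluidState.lambdaMinus l r) : l.p < r.p ∧ r.u < l.u := by
  obtain ⟨s, hRH, hrs, hsl⟩ := H
  obtain ⟨h0, h1, h2⟩ := hRH.fluxes
  have hs : 0 < 1 - s ^ 2 := by
    have h3 := abs_lt.1 hl.abs_lambdaMinus_lt
    have h4 := abs_lt.1 hr.abs_lambdaMinus_lt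
    nlinarith
  have hs1 := abs_lt.1 ((sq_lt_one_iff_abs_lt_one s).1 (by linarith))
  have hul := abs_lt.1 hl.2.2
  have hur := abs_lt.1 hr.2.2
  have hdl : 0 < 1 - l.u * s := by nlinarith
  have hdr : 0 < 1 - r.u * s := by nlinarith
  have hUl := hl.U0_pos
  have hUr := hr.U0_pos
  have hhl := hl.h_pos
  have hhr := hr.h_pos
  have hρl := hl.1
  have hρr := hr.1
  obtain ⟨hsu, hsup⟩ := hl.supersonic (abs_lt.2 hs1) hsl
  have hvl : 0 < l.u - s := by linarith
  set J := l.ρ * l.U0 * (l.u - s) with hJ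
  have hJpos : 0 < J := by positivity
  rw [h0] at h1 h2
  -- Up to the factor `(1 - s²)^(-1/2)`, `h U⁰ (u - s)` and `h U⁰ (1 - u s)` are the momentum and
  -- the energy per unit of rest mass in the frame of the shock. The energy is conserved, and the
  -- momentum is the mass flux times `h / ρ`.
  have hαl : l.h * l.U0 * (l.u - s) = J * (l.h / l.ρ) := by
    rw [hJ]
    field_simp
  have hαr : r.h * r.U0 * (r.u - s) = J * (r.h / r.ρ) := by
    rw [← h0]
    field_simp
  have hβ : r.h * r.U0 * (1 - r.u * s) = l.h * l.U0 * (1 - l.u * s) := by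
    apply mul_left_cancel₀ hJpos.ne'
    linear_combination h2 - s * h1
  have hX : J ^ 2 * (r.h / r.ρ - l.h / l.ρ) = -(1 - s ^ 2) * (r.p - l.p) := by
    linear_combination J * hαl - J * hαr + h1 - s * h2
  have hnorm : ∀ V : FluidState, V.Admissible →
      (1 - s ^ 2) * V.h ^ 2 = (V.h * V.U0 * (1 - V.u * s)) ^ 2 - (V.h * V.U0 * (V.u - s)) ^ 2 := by
    intro V hV
    linear_combination -(1 - s ^ 2) * V.h ^ 2 * hV.U0_sq
  have htaub : r.h ^ 2 - l.h ^ 2 = (r.p - l.p) * (l.h / l.ρ + r.h / r.ρ) := by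
    apply mul_left_cancel₀ hs.ne'
    have e1 := hnorm l hl
    have e2 := hnorm r hr
    rw [hαl] at e1
    rw [hαr, hβ] at e2
    linear_combination e2 - e1 - (l.h / l.ρ + r.h / r.ρ) * hX
  have hle : l.p ≤ r.p := by
    refine pressure_le_of_taub (m := (1 - s ^ 2) / J ^ 2) hρl hl.2.1 hρr hr.2.1 ?_ htaub ?_
    · change r.h / r.ρ - l.h / l.ρ = _
      field_simp at hX ⊢
      linear_combination hX
    · rwa [div_lt_div_iff₀ (by positivity) (by positivity)]
  -- Equal pressures would force equal states, against the Lax condition.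
  have hne : l.p ≠ r.p := by
    intro hp
    rw [hRH.eq_of_pressure_eq hl hsu hp] at hrs
    linarith
  have hlt : l.p < r.p := lt_of_le_of_ne hle hne
  refine ⟨hlt, ?_⟩
  -- The relative velocity `(u - s) / (1 - u s)` is proportional to `h / ρ`.
  have hXlt : r.h / r.ρ < l.h / l.ρ := by
    by_contra! hcon
    have h3 : 0 ≤ J ^ 2 * (r.h / r.ρ - l.h / l.ρ) := mul_nonneg (by positivity) (by linarith)
    nlinarith
  have hα : r.h * r.U0 * (r.u - s) < l.h * l.U0 * (l.u - s) := by
    rw [hαl, hαr]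
    gcongr
  by_contra! hcon
  have hv : (l.u - s) * (1 - r.u * s) ≤ (r.u - s) * (1 - l.u * s) := by
    linear_combination mul_nonneg (sub_nonneg.2 hcon) hs.le
  have hβr : 0 < r.h * r.U0 * (1 - r.u * s) := by positivity
  have hBr : 0 < r.h * r.U0 := by positivity
  have hBl : 0 < l.h * l.U0 := by positivity
  have e1 : r.h * r.U0 * (r.u - s) * (l.h * l.U0 * (1 - l.u * s)) <
      l.h * l.U0 * (l.u - s) * (r.h * r.U0 * (1 - r.u * s)) := by
    rw [← hβ]
    exact mul_lt_mul_of_pos_right hα hβr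
  have e2 := mul_le_mul_of_nonneg_left hv (mul_pos hBr hBl).le
  linarith

/-! ### Rarefaction waves -/

/-- Pointwise form of the Euler equations along a centered wave, at a point where the wave speed
differs from the velocity of the gas. The first relation is adiabaticity, `dh = dp / ρ`; the second
one is the momentum balance. -/
lemma rarefaction_relations {V : ℝ → FluidState} {ξ ρ' u' p' h' : ℝ} {D : Fin 3 → ℝ}
    (hV : (V ξ).Admissible) (hρ : HasDerivAt (fun η => (V η).ρ) ρ' ξ)
    (hu : HasDerivAt (fun η => (V η).u) u' ξ) (hp : HasDerivAt (fun η => (V η).p) p' ξ)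
    (hh : HasDerivAt (fun η => (V η).h) h' ξ) (hW : HasDerivAt (fun η => (V η).W) D ξ)
    (hF : HasDerivAt (fun η => (V η).F) (ξ • D) ξ) (hne : (V ξ).u - ξ ≠ 0) :
    p' = (V ξ).ρ * h' ∧
      p' * (1 - ξ * (V ξ).u) = -(V ξ).ρ * (V ξ).h * (V ξ).U0 ^ 2 * u' * ((V ξ).u - ξ) := by
  have hsq := hV.sq_lt
  have hUpos := hV.U0_pos
  have hUsq := hV.U0_sq
  have hU : HasDerivAt (fun η => (V η).U0) ((V ξ).U0 ^ 3 * (V ξ).u * u') ξ := by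
    have h1 : HasDerivAt (fun η => Real.sqrt (1 - (V η).u ^ 2)) _ ξ :=
      ((hu.pow 2).const_sub 1).sqrt hsq.ne'
    have h2 := h1.inv (Real.sqrt_pos.2 hsq).ne'
    simp only [FluidState.U0, one_div]
    refine h2.congr_deriv ?_
    simp only [Pi.pow_apply]
    have := Real.sqrt_pos.2 hsq
    field_simp
    ring
  have hm := hρ.mul hU
  have hB := hh.mul hU
  have hA := hB.mul hu
  have dW := hasDerivAt_pi.1 hW
  have dF := hasDerivAt_pi.1 hF
  have w0 := (dW 0).unique (hm.congr_of_eventuallyEq (.of_forall fun η => by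
    simp [FluidState.W]))
  have w1 := (dW 1).unique ((hm.mul hA).congr_of_eventuallyEq (.of_forall fun η => by
    simp [FluidState.W, FluidState.U1]; ring))
  have w2 := (dW 2).unique (((hm.mul hB).sub hp).congr_of_eventuallyEq (.of_forall fun η => by
    simp [FluidState.W]; ring))
  have f0 := (dF 0).unique ((hm.mul hu).congr_of_eventuallyEq (.of_forall fun η => by
    simp [FluidState.F, FluidState.U1]; ring))
  have f1 := (dF 1).unique ((((hm.mul hu).mul hA).add hp).congr_of_eventuallyEq
    (.of_forall fun η => by simp [FluidState.F, FluidState.U1]; ring))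
  have f2 := (dF 2).unique (((hm.mul hu).mul hB).congr_of_eventuallyEq
    (.of_forall fun η => by simp [FluidState.F, FluidState.U1]; ring))
  simp only [Pi.smul_apply, smul_eq_mul, Pi.mul_apply] at w0 w1 w2 f0 f1 f2
  rw [w0] at f0
  rw [w1] at f1
  rw [w2] at f2
  set ρ := (V ξ).ρ
  set u := (V ξ).u
  set h := (V ξ).h
  set U := (V ξ).U0
  -- Momentum and energy balance, simplified by the conservation of mass.
  have mom : ρ * U * (u - ξ) * ((h' * U + h * (U ^ 3 * u * u')) * u + h * U * u') + p' = 0 := by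
    linear_combination h * U * u * f0 - f1
  have ener : ρ * U * (u - ξ) * (h' * U + h * (U ^ 3 * u * u')) + ξ * p' = 0 := by
    linear_combination h * U * f0 - f2
  constructor
  · apply mul_left_cancel₀ hne
    linear_combination u * mom - ener +
      ((u - ξ) * ρ * h' + ρ * U ^ 2 * (u - ξ) * h * u * u') * hUsq
  · linear_combination mom - u * ener

/-- Inside a rarefaction fan of the field `λ_-` the pressure decreases and the velocity increases.
The Euler equations express `p'` and `u'` by the derivative of the coldness, and genuine
nonlinearity fixes its sign, since `λ_-` has derivative one. -/
lemma rarefaction_deriv_signs {V : ℝ → FluidState} {ξ : ℝ} {D : Fin 3 → ℝ}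
    (hV : ∀ᶠ η in 𝓝 ξ, (V η).Admissible ∧ (V η).lambdaMinus = η)
    (hρ : DifferentiableAt ℝ (fun η => (V η).ρ) ξ) (hu : DifferentiableAt ℝ (fun η => (V η).u) ξ)
    (hp : DifferentiableAt ℝ (fun η => (V η).p) ξ) (hW : HasDerivAt (fun η => (V η).W) D ξ)
    (hF : HasDerivAt (fun η => (V η).F) (ξ • D) ξ) :
    deriv (fun η => (V η).p) ξ < 0 ∧ 0 < deriv (fun η => (V η).u) ξ := by
  obtain ⟨hadm, hlam⟩ := hV.self_of_nhds
  have hz := hadm.zeta_pos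
  obtain ⟨z', hz'⟩ : ∃ z', HasDerivAt (fun η => (V η).ρ / (V η).p) z' ξ :=
    ⟨_, (hρ.div hp hadm.2.1.ne').hasDerivAt⟩
  have hh : HasDerivAt (fun η => (V η).h) _ ξ :=
    HasDerivAt.comp ξ (h := fun η => (V η).ρ / (V η).p) (hasDerivAt_G hz) hz'
  have hR := one_lt_invSqSound hz
  have hRd := (hasDerivAt_invSqSound hz).differentiableAt.hasDerivAt
  -- The speed of sound is differentiated through `c_s² R = 1`.
  have hc : HasDerivAt (fun η => (V η).cs)
      (-((V ξ).cs ^ 3 / 2) * (deriv invSqSound ((V ξ).ρ / (V ξ).p) * z')) ξ := by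
    have h1 : HasDerivAt (fun η => invSqSound ((V η).ρ / (V η).p)) _ ξ :=
      HasDerivAt.comp ξ (h := fun η => (V η).ρ / (V η).p) hRd hz'
    have h2 := (h1.sqrt (by linarith)).inv (Real.sqrt_pos.2 (by linarith)).ne'
    refine (h2.congr_of_eventuallyEq ?_).congr_deriv ?_
    · filter_upwards [hV] with η hη
      exact soundSpeed_eq hη.1.1 hη.1.2.1
    · have h3 : (V ξ).cs = _ := soundSpeed_eq hadm.1 hadm.2.1
      rw [h3]
      have := Real.sqrt_pos.2 (show 0 < invSqSound ((V ξ).ρ / (V ξ).p) by linarith)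
      field_simp
  have hud := hu.hasDerivAt
  have hpd := hp.hasDerivAt
  have hcpos := hadm.cs_pos
  have hUpos := hadm.U0_pos
  have hUsq := hadm.U0_sq
  have hc2 := hadm.cs_sq
  have h1uc := hadm.one_sub_pos
  have hspeed : (V ξ).u - (V ξ).cs = ξ * (1 - (V ξ).u * (V ξ).cs) := by
    have := hlam
    rwa [FluidState.lambdaMinus, div_eq_iff h1uc.ne'] at this
  -- Derivative of `λ_- = ξ`, with the denominator cleared.
  have hdspeed := (hud.sub hc).unique
    (((hasDerivAt_id ξ).mul ((hud.mul hc).const_sub 1)).congr_of_eventuallyEq (by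
      filter_upwards [hV] with η hη
      have := hη.2
      rwa [FluidState.lambdaMinus, div_eq_iff hη.1.one_sub_pos.ne'] at this))
  simp only [id, Pi.mul_apply] at hdspeed
  have hrel : (V ξ).u - ξ = (V ξ).cs * (1 - ξ * (V ξ).u) := by linear_combination hspeed
  have hd : 0 < 1 - ξ * (V ξ).u := by
    have h1 := abs_lt.1 hadm.abs_lambdaMinus_lt
    have h2 := abs_lt.1 hadm.2.2
    rw [hlam] at h1
    nlinarith
  obtain ⟨r1, r2⟩ := rarefaction_relations hadm hρ.hasDerivAt hud hpd hh hW hF (by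
    rw [hrel]
    exact (mul_pos hcpos hd).ne')
  have hnl := genuinely_nonlinear hz
  have ha := specificHeat_gt hz
  have hhpos := hadm.h_pos
  have hρpos := hadm.1
  have hRdef : invSqSound ((V ξ).ρ / (V ξ).p) * specificHeat ((V ξ).ρ / (V ξ).p) =
      (V ξ).ρ / (V ξ).p * (V ξ).h * (specificHeat ((V ξ).ρ / (V ξ).p) - 1) :=
    div_mul_cancel₀ _ (by linarith)
  clear hh hRd hc hV hz' hlam hρ hu hp hW hF
  set p' := deriv (fun η => (V η).p) ξ
  set u' := deriv (fun η => (V η).u) ξ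
  set z := (V ξ).ρ / (V ξ).p
  set R := invSqSound z
  set R' := deriv invSqSound z
  set a := specificHeat z
  set ρ := (V ξ).ρ
  set u := (V ξ).u
  set c := (V ξ).cs
  set h := (V ξ).h
  set U := (V ξ).U0
  have hp' : p' = -ρ * h * U ^ 2 * u' * c := by
    apply mul_right_cancel₀ hd.ne'
    rw [r2, hrel]
    ring
  have hu' : z ^ 2 * h * c * (U ^ 2 * u') = a * z' := by
    have h1 : -ρ * h * U ^ 2 * u' * c = ρ * (-a / z ^ 2 * z') := by rw [← hp', r1]
    have h2 : h * U ^ 2 * u' * c = a / z ^ 2 * z' := by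
      apply mul_left_cancel₀ hρpos.ne'
      linear_combination -h1
    field_simp at h2
    linear_combination h2
  have hunit : U ^ 2 * u' * (1 - c ^ 2) + c ^ 3 / 2 * (R' * z') = U ^ 2 * (1 - u * c) ^ 2 := by
    have e1 : (1 - u * c) * (1 + ξ * c) = 1 - c ^ 2 := by linear_combination -c * hspeed
    have e2 : (1 - u * c) * (1 - ξ * u) = 1 - u ^ 2 := by linear_combination u * hspeed
    linear_combination U ^ 2 * (1 - u * c) * hdspeed - U ^ 2 * u' * e1 -
      U ^ 2 * (c ^ 3 / 2 * (R' * z')) * e2 - c ^ 3 / 2 * (R' * z') * hUsq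
  have hprod : z' * (z * R' + 2 * (R - 1) * (a - 1)) =
      2 * z / c ^ 3 * (U ^ 2 * (1 - u * c) ^ 2) := by
    have e : z' * (2 * (R - 1) * (a - 1)) * c ^ 3 = 2 * z * (U ^ 2 * u' * (1 - c ^ 2)) := by
      apply mul_left_cancel₀ (show z * h * c ≠ 0 by positivity)
      linear_combination (-2 * z' * c ^ 4 * (R - 1)) * hRdef - 2 * (1 - c ^ 2) * hu' +
        2 * z' * a * (c ^ 2 * R + 1 - c ^ 2) * hc2
    rw [← hunit]
    field_simp
    linear_combination e
  have hzpos : 0 < z' := by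
    have h1 : 0 < z' * (z * R' + 2 * (R - 1) * (a - 1)) := by
      rw [hprod]
      positivity
    exact pos_of_mul_pos_left h1 hnl.le
  have hupos : 0 < u' := by
    have h1 : 0 < z ^ 2 * h * c * (U ^ 2 * u') := by
      rw [hu']
      exact mul_pos (by linarith) hzpos
    exact pos_of_mul_pos_right (pos_of_mul_pos_right h1 (by positivity)) (by positivity)
  refine ⟨?_, hupos⟩
  have : 0 < ρ * h * U ^ 2 * u' * c := by positivity
  linarith

lemma isRarefaction_lambdaMinus {l r : FluidState}
    (H : IsRarefaction FluidState.lambdaMinus l r) : r.p < l.p ∧ l.u < r.u := by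
  obtain ⟨a, b, V, hab, rfl, rfl, hV, -, hu, hp, hd⟩ := H
  have key : ∀ ξ ∈ Ioo a b,
      deriv (fun η => (V η).p) ξ < 0 ∧ 0 < deriv (fun η => (V η).u) ξ := by
    intro ξ hξ
    obtain ⟨h1, h2, h3, D, hW, hF⟩ := hd ξ hξ
    refine rarefaction_deriv_signs ?_ h1 h2 h3 hW hF
    filter_upwards [Icc_mem_nhds hξ.1 hξ.2] with η hη using hV η hη
  have ha : a ∈ Icc a b := left_mem_Icc.2 hab.le
  have hb : b ∈ Icc a b := right_mem_Icc.2 hab.le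
  refine ⟨strictAntiOn_of_deriv_neg (convex_Icc a b) hp (fun ξ hξ => ?_) ha hb hab,
    strictMonoOn_of_deriv_pos (convex_Icc a b) hu (fun ξ hξ => ?_) ha hb hab⟩
  · rw [interior_Icc] at hξ
    exact (key ξ hξ).1
  · rw [interior_Icc] at hξ
    exact (key ξ hξ).2

/-! ### Reflection of space -/

namespace FluidState

/-- The image of a state under the reflection `x ↦ -x`. It exchanges the two acoustic fields. -/
def mirror (V : FluidState) : FluidState := ⟨V.ρ, -V.u, V.p⟩

lemma Admissible.mirror {V : FluidState} (hV : V.Admissible) : V.mirror.Admissible :=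
  ⟨hV.1, hV.2.1, by simpa [FluidState.mirror] using hV.2.2⟩

lemma lambdaMinus_mirror (V : FluidState) : V.mirror.lambdaMinus = -V.lambdaPlus := by
  simp only [lambdaMinus, lambdaPlus, mirror, cs]
  rw [← neg_div]
  ring_nf

lemma W_mirror (V : FluidState) : V.mirror.W = ![V.W 0, -V.W 1, V.W 2] := by
  simp [W, mirror, U1, U0, h]

lemma F_mirror (V : FluidState) : V.mirror.F = ![-V.F 0, V.F 1, -V.F 2] := by
  simp [F, mirror, U1, U0, h]

end FluidState

lemma RankineHugoniot.mirror {s : ℝ} {l r : FluidState} (H : RankineHugoniot s l r) :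
    RankineHugoniot (-s) r.mirror l.mirror := by
  have h0 := congrFun H 0
  have h1 := congrFun H 1
  have h2 := congrFun H 2
  simp only [Pi.smul_apply, Pi.sub_apply, smul_eq_mul] at h0 h1 h2
  unfold RankineHugoniot
  simp only [FluidState.W_mirror, FluidState.F_mirror]
  ext i
  fin_cases i <;> simp <;> linarith

lemma IsShock.mirror {l r : FluidState} (H : IsShock FluidState.lambdaPlus l r) :
    IsShock FluidState.lambdaMinus r.mirror l.mirror := by
  obtain ⟨s, hRH, h1, h2⟩ := H
  refine ⟨-s, hRH.mirror, ?_, ?_⟩ <;> rw [FluidState.lambdaMinus_mirror] <;> linarith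

lemma IsRarefaction.mirror {l r : FluidState} (H : IsRarefaction FluidState.lambdaPlus l r) :
    IsRarefaction FluidState.lambdaMinus r.mirror l.mirror := by
  obtain ⟨a, b, V, hab, rfl, rfl, hV, hρ, hu, hp, hd⟩ := H
  have hmaps : MapsTo (fun ξ : ℝ => -ξ) (Icc (-b) (-a)) (Icc a b) := fun ξ hξ =>
    ⟨by linarith [hξ.2], by linarith [hξ.1]⟩
  refine ⟨-b, -a, fun ξ => (V (-ξ)).mirror, by linarith, by simp, by simp, fun ξ hξ => ?_,
    hρ.comp continuousOn_neg hmaps, (hu.comp continuousOn_neg hmaps).neg,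
    hp.comp continuousOn_neg hmaps, fun ξ hξ => ?_⟩
  · obtain ⟨h1, h2⟩ := hV (-ξ) (hmaps hξ)
    exact ⟨h1.mirror, by rw [FluidState.lambdaMinus_mirror, h2, neg_neg]⟩
  · obtain ⟨h1, h2, h3, D, hW, hF⟩ := hd (-ξ) ⟨by linarith [hξ.2], by linarith [hξ.1]⟩
    have hneg : DifferentiableAt ℝ (fun ξ : ℝ => -ξ) ξ := differentiableAt_id.neg
    refine ⟨h1.comp ξ hneg, (h2.comp ξ hneg).neg, h3.comp ξ hneg, ![-D 0, D 1, -D 2], ?_, ?_⟩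
    · have hW' : ∀ i, HasDerivAt (fun η => (V (-η)).W i) (D i * -1) ξ := fun i =>
        HasDerivAt.comp ξ (h := fun η : ℝ => -η) (hasDerivAt_pi.1 hW i) (hasDerivAt_neg ξ)
      simp only [FluidState.W_mirror]
      refine hasDerivAt_pi.2 fun i => ?_
      fin_cases i
      · simpa using hW' 0
      · simpa using (hW' 1).fun_neg
      · simpa using hW' 2
    · have hF' : ∀ i, HasDerivAt (fun η => (V (-η)).F i) (-ξ * D i * -1) ξ := fun i =>
        HasDerivAt.comp ξ (h := fun η : ℝ => -η) (hasDerivAt_pi.1 hF i) (hasDerivAt_neg ξ)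
      simp only [FluidState.F_mirror]
      refine hasDerivAt_pi.2 fun i => ?_
      fin_cases i
      · simpa using (hF' 0).fun_neg
      · simpa using hF' 1
      · simpa using (hF' 2).fun_neg

end SyngeRHD

end

theorem mainTheorem2 (l r : SyngeRHD.FluidState) (hl : l.Admissible) (hr : r.Admissible) :
    ((SyngeRHD.IsShock SyngeRHD.FluidState.lambdaMinus l r → l.p < r.p ∧ r.u < l.u) ∧
      (SyngeRHD.IsRarefaction SyngeRHD.FluidState.lambdaMinus l r → r.p < l.p ∧ l.u < r.u)) ∧
    ((SyngeRHD.IsShock SyngeRHD.FluidState.lambdaPlus l r → r.p < l.p ∧ r.u < l.u) ∧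
      (SyngeRHD.IsRarefaction SyngeRHD.FluidState.lambdaPlus l r → l.p < r.p ∧ l.u < r.u)) ∧
    (SyngeRHD.IsContact l r → l.p = r.p ∧ l.u = r.u) := by
  refine ⟨⟨SyngeRHD.isShock_lambdaMinus hl hr, SyngeRHD.isRarefaction_lambdaMinus⟩,
    ⟨fun H => ?_, fun H => ?_⟩, SyngeRHD.IsContact.eq hl hr⟩
  · obtain ⟨hp, hu⟩ := SyngeRHD.isShock_lambdaMinus hr.mirror hl.mirror H.mirror
    exact ⟨hp, neg_lt_neg_iff.1 hu⟩
  · obtain ⟨hp, hu⟩ := SyngeRHD.isRarefaction_lambdaMinus H.mirror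
    exact ⟨hp, neg_lt_neg_iff.1 hu⟩
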